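/- Theorem 2.8. Let $(X,\mathcal B,\mu)$ be a $\sigma$-finite measure space such that $(X,\mathcal B)$ is a standard Borel space. Let $U=(U_t)_{t\in\mathbb R}$ be a $C_0$-group on the complex space $L_2(X)=L_2(X,\mathcal B,\mu)$, that is, a family of bounded linear operators with $U_0=I$, $U_{s+t}=U_sU_t$ for all $s,t\in\mathbb R$, and $t\mapsto U_tf$ continuous for every $f\in L_2(X)$. Let $A$ be its generator: $D(A)$ is the set of all $f\in L_2(X)$ for which $Af:=\lim_{t\to0}\frac1t(U_tf-f)$ exists in $L_2(X)$. Then the following are equivalent. (i) For all $t\in\mathbb R$ there exists a measurable map $T_t\colon X\to X$ such that $U_tf=f\circ T_t$ a.e. for all $f\in L_2(X)$ (that is, for every function $f$ representing an element of $L_2(X)$; in particular the class of $f\circ T_t$ depends only on that of $f$). (ii) The space $D(A)\cap L_\infty(X)$ is an algebra under pointwise multiplication, and $A$ is a derivation on it, i.e. $A(fg)=(Af)\,g+f\,(Ag)$ for all $f,g\in D(A)\cap L_\infty(X)$. Moreover, there exists a $c>0$ such that $$\|U_tf\|_\infty\le c\,\|f\|_\infty$$ for all $t\in[-1,1]$ and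 all $f\in L_2(X)\cap L_\infty(X)$. -/

import Mathlib

open MeasureTheory Filter Topology
open scoped ENNReal

namespace Koopman

/-- A `C_0`-group (strongly continuous one-parameter group) of bounded linear operators on a
complex normed space. -/
structure C0Group (E : Type*) [NormedAddCommGroup E] [NormedSpace ℂ E] where
  /-- the operator `U_t` -/
  op : ℝ → E →L[ℂ] E
  op_zero : op 0 = ContinuousLinearMap.id ℂ E
  op_add : ∀ s t : ℝ, op (s + t) = (op s).comp (op t)
  continuous_orbit : ∀ x : E, Continuous fun t : ℝ => op t x

namespace C0Group

variable {E : Type*} [NormedAddCommGroup E] [NormedSpace ℂ E]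

/-- `y` is the limit of `(U_t x - x) / t` as `t → 0`, that is, `x ∈ D(A)` and `A x = y`. -/
def HasGenerator (U : C0Group E) (x y : E) : Prop :=
  Tendsto (fun t : ℝ => ((t : ℂ)⁻¹) • (U.op t x - x)) (𝓝[≠] 0) (𝓝 y)

theorem HasGenerator.unique {U : C0Group E} {x y z : E} (hy : U.HasGenerator x y)
    (hz : U.HasGenerator x z) : y = z :=
  tendsto_nhds_unique hy hz

theorem HasGenerator.add {U : C0Group E} {x x' y y' : E} (h : U.HasGenerator x y)
    (h' : U.HasGenerator x' y') : U.HasGenerator (x + x') (y + y') := by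
  refine (Tendsto.add h h').congr fun t => ?_
  rw [map_add, ← smul_add]
  congr 1
  abel

theorem HasGenerator.smul {U : C0Group E} {x y : E} (a : ℂ) (h : U.HasGenerator x y) :
    U.HasGenerator (a • x) (a • y) := by
  refine (Tendsto.const_smul h a).congr fun t => ?_
  rw [map_smul, ← smul_sub, smul_comm]

theorem hasGenerator_zero (U : C0Group E) : U.HasGenerator 0 0 := by
  simp [HasGenerator]

/-- The generator `A` of a `C_0`-group, as a partially defined linear operator: its domain `D(A)`
consists of all `x` for which `(U_t x - x) / t` converges in norm as `t → 0`, and `A x` is the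
limit. -/
noncomputable def generator (U : C0Group E) : E →ₗ.[ℂ] E where
  domain :=
    { carrier := {x | ∃ y, U.HasGenerator x y}
      add_mem' := fun ⟨_, h⟩ ⟨_, h'⟩ => ⟨_, h.add h'⟩
      zero_mem' := ⟨0, U.hasGenerator_zero⟩
      smul_mem' := fun a _ ⟨_, h⟩ => ⟨_, h.smul a⟩ }
  toFun :=
    { toFun := fun x => Classical.choose x.2
      map_add' := fun x y => HasGenerator.unique (Classical.choose_spec (x + y).2)
        ((Classical.choose_spec x.2).add (Classical.choose_spec y.2))
      map_smul' := fun a x => HasGenerator.unique (Classical.choose_spec (a • x).2)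
        ((Classical.choose_spec x.2).smul a) }

end C0Group

section L2

variable {X : Type*} [MeasurableSpace X] {μ : Measure X}

variable (μ) in
/-- The subspace `L_2 ∩ L_∞` of `L_2`. -/
def L2Linfty : Submodule ℂ (Lp ℂ 2 μ) where
  carrier := {f | MemLp (f : X → ℂ) ∞ μ}
  add_mem' := fun {f g} hf hg => (memLp_congr_ae (Lp.coeFn_add f g)).2 (MemLp.add hf hg)
  zero_mem' := (memLp_congr_ae (Lp.coeFn_zero ℂ 2 μ)).2 MemLp.zero
  smul_mem' := fun a f hf => (memLp_congr_ae (Lp.coeFn_smul a f)).2 (MemLp.const_smul hf a)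

/-- A linear subspace of `L_2` is an algebra if it is closed under pointwise (a.e.)
multiplication. -/
def IsFunctionAlgebra (D : Submodule ℂ (Lp ℂ 2 μ)) : Prop :=
  ∀ f ∈ D, ∀ g ∈ D, ∃ h ∈ D, (h : X → ℂ) =ᵐ[μ] fun x => f x * g x

/-- `A` is a derivation on `D`: `D ⊆ D(A)`, and whenever `f`, `g` and their product `h = f g` are
in `D`, one has `A (f g) = (A f) g + f (A g)` almost everywhere. -/
def IsDerivationOn (A : Lp ℂ 2 μ →ₗ.[ℂ] Lp ℂ 2 μ) (D : Submodule ℂ (Lp ℂ 2 μ)) : Prop :=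
  D ≤ A.domain ∧
    ∀ f g h : A.domain, (f : Lp ℂ 2 μ) ∈ D → (g : Lp ℂ 2 μ) ∈ D → (h : Lp ℂ 2 μ) ∈ D →
      ((h : Lp ℂ 2 μ) : X → ℂ) =ᵐ[μ]
        (fun x => (f : Lp ℂ 2 μ) x * (g : Lp ℂ 2 μ) x) →
      (A h : X → ℂ) =ᵐ[μ] fun x => A f x * (g : Lp ℂ 2 μ) x + (f : Lp ℂ 2 μ) x * A g x

/-- The operator `S` on `L_2` is composition with the map `T`, that is `S f = f ∘ T` for all
`f ∈ L_2`. The equation is required for every function `f` that represents an element of `L_2`,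
so that `f ∘ T` is well defined as an equivalence class. -/
def IsCompositionWith (S : Lp ℂ 2 μ →L[ℂ] Lp ℂ 2 μ) (T : X → X) : Prop :=
  ∀ (f : X → ℂ) (hf : MemLp f 2 μ), (S (hf.toLp f) : X → ℂ) =ᵐ[μ] f ∘ T

end L2

end Koopman

/-! If every `U_t` is composition with a map, it is multiplicative and contracts the sup norm, so
differentiating `U_t f · U_t g` at `0` gives the product rule. Conversely, for `f, g` in `D(A) ∩
L_∞` the derivation property says that the curve `s ↦ U_s f · U_s g` solves `h' = A h`. Solutions
are orbits (`eq_op_of_hasGenerator`), hence `U_t (f g) = U_t f · U_t g`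
(`op_mul_of_isDerivationOn`). Averaging orbits approximates bounded functions by uniformly bounded
elements of `D(A)`, which extends this to `L_2 ∩ L_∞` (`isMulIso_op`). A multiplicative isomorphism
then comes from a point map. Fix a bounded, nowhere vanishing `w` in `L_2`. The restrictions of `w`
to sets are the solutions of `u² = u w`, so `S` induces a map of sets modulo null sets that respects
countable Boolean operations; in a standard Borel space it is realised by a measurable `T`
(`exists_measurable_corresponds`). -/

namespace Koopman.C0Group

/-! ### Orbits and generators in a Banach space. -/

section Abstract

variable {E : Type*} [NormedAddCommGroup E] [NormedSpace ℂ E] (U : C0Group E)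

theorem op_add_apply (s t : ℝ) (x : E) : U.op (s + t) x = U.op s (U.op t x) := by
  rw [U.op_add]; rfl

theorem op_zero_apply (x : E) : U.op 0 x = x := by
  rw [U.op_zero]; rfl

theorem op_neg_op_apply (t : ℝ) (x : E) : U.op (-t) (U.op t x) = x := by
  rw [← op_add_apply, neg_add_cancel, op_zero_apply]

theorem op_op_neg_apply (t : ℝ) (x : E) : U.op t (U.op (-t) x) = x := by
  rw [← op_add_apply, add_neg_cancel, op_zero_apply]

variable {U}

theorem hasGenerator_generator (x : U.generator.domain) :
    U.HasGenerator (x : E) (U.generator x) :=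
  Classical.choose_spec x.2

theorem HasGenerator.op {x y : E} (h : U.HasGenerator x y) (s : ℝ) :
    U.HasGenerator (U.op s x) (U.op s y) := by
  refine (((U.op s).continuous.tendsto y).comp h).congr fun t => ?_
  simp [← op_add_apply, add_comm]

theorem HasGenerator.tendsto_orbit {x y : E} (h : U.HasGenerator x y) (s : ℝ) :
    Tendsto (fun r : ℝ => (r : ℂ)⁻¹ • (U.op (s + r) x - U.op s x)) (𝓝[≠] 0)
      (𝓝 (U.op s y)) := by
  refine (h.op s).congr fun t => ?_
  rw [← op_add_apply, add_comm]

variable (U)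

theorem tendsto_op_zero (x : E) : Tendsto (fun r : ℝ => U.op r x) (𝓝[≠] 0) (𝓝 x) := by
  have := (U.continuous_orbit x).tendsto 0
  rw [op_zero_apply] at this
  exact this.mono_left nhdsWithin_le_nhds

/-- Orbits are bounded on compact intervals by continuity; Banach–Steinhaus makes the bound uniform.
-/
theorem exists_norm_op_le [CompleteSpace E] (a b : ℝ) :
    ∃ C, ∀ t ∈ Set.Icc a b, ‖U.op t‖ ≤ C := by
  obtain ⟨C, hC⟩ := banach_steinhaus (g := fun t : Set.Icc a b => U.op t) fun x => by
    obtain ⟨C, hC⟩ := isCompact_Icc.exists_bound_of_continuousOn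
      (U.continuous_orbit x).continuousOn (s := Set.Icc a b)
    exact ⟨C, fun t => hC t t.2⟩
  exact ⟨C, fun t ht => hC ⟨t, ht⟩⟩

/-- A differentiable curve `h` in `D(A)` with `h' = A h` is an orbit. -/
theorem eq_op_of_hasGenerator [CompleteSpace E] {h h' : ℝ → E}
    (hh : ∀ s, Tendsto (fun r : ℝ => (r : ℂ)⁻¹ • (h (s + r) - h s)) (𝓝[≠] 0) (𝓝 (h' s)))
    (hg : ∀ s, U.HasGenerator (h s) (h' s)) (s : ℝ) : h s = U.op s (h 0) := by
  -- Variation of constants: `U_{-s} h(s)` is constant. Its difference quotient is `U_{-(s+r)}`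
  -- applied to a difference of two quotients that both tend to `h' s`, so a local norm bound
  -- suffices.
  have hd : ∀ s, HasDerivAt (fun s => U.op (-s) (h s)) 0 s := by
    intro s
    rw [hasDerivAt_iff_tendsto_slope_zero]
    obtain ⟨C, hC⟩ := U.exists_norm_op_le (-s - 1) (-s + 1)
    have h0 := (hh s).sub (hg s)
    rw [sub_self] at h0
    have h1 := (h0.norm).const_mul C
    rw [norm_zero, mul_zero] at h1
    refine squeeze_zero_norm' ?_ h1
    have hr : ∀ᶠ r : ℝ in 𝓝[≠] 0, r ∈ Set.Icc (-1 : ℝ) 1 :=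
      nhdsWithin_le_nhds (Icc_mem_nhds (by norm_num) (by norm_num))
    filter_upwards [hr] with r hr
    have hb : U.op (-s) (h s) = U.op (-(s + r)) (U.op r (h s)) := by
      rw [← op_add_apply]; congr 2; ring
    have hs : (r⁻¹ • (U.op (-(s + r)) (h (s + r)) - U.op (-s) (h s)) : E) =
        U.op (-(s + r)) ((r : ℂ)⁻¹ • (h (s + r) - h s) - (r : ℂ)⁻¹ • (U.op r (h s) - h s)) := by
      rw [hb, ← map_sub, ← smul_sub, map_smul, ← Complex.ofReal_inv, Complex.coe_smul]
      congr 2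
      abel
    rw [hs]
    refine ((U.op (-(s + r))).le_opNorm _).trans ?_
    gcongr
    exact hC _ ⟨by linarith [hr.2], by linarith [hr.1]⟩
  have := is_const_of_deriv_eq_zero (fun s => (hd s).differentiableAt) (fun s => (hd s).deriv) s 0
  simp only [neg_zero, op_zero_apply] at this
  rw [← this, op_op_neg_apply]

/-- A vector whose orbit stays in a closed convex set `K` is approximated by elements of
`D(A) ∩ K`. -/
theorem exists_seq_domain_tendsto [CompleteSpace E] {K : Set E} (hK : IsClosed K)
    (hconv : ∀ x ∈ K, ∀ y ∈ K, ∀ a b : ℝ, 0 ≤ a → 0 ≤ b → a + b = 1 →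
      (a : ℂ) • x + (b : ℂ) • y ∈ K) {x : E} (hx : ∀ t ∈ Set.Icc (0 : ℝ) 1, U.op t x ∈ K) :
    ∃ u : ℕ → E, (∀ n, u n ∈ U.generator.domain ∧ u n ∈ K) ∧ Tendsto u atTop (𝓝 x) := by
  have hc : Convex ℝ K := by
    intro y hy z hz a b ha hb hab
    simpa only [Complex.coe_smul] using hconv y hy z hz a b ha hb hab
  -- The average `t⁻¹ F(t)` lies in `K` by convexity and closedness, in `D(A)` because `U_r F(t) =
  -- F(t + r) - F(r)`, and tends to `F'(0) = x`.
  let F : ℝ → E := fun t => ∫ s in (0 : ℝ)..t, U.op s x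
  have hF : ∀ t, HasDerivAt F (U.op t x) t := fun t =>
    ((U.continuous_orbit x).integral_hasStrictDerivAt 0 t).hasDerivAt
  have hint : ∀ a b, IntervalIntegrable (fun s => U.op s x) volume a b := fun a b =>
    (U.continuous_orbit x).intervalIntegrable a b
  have hUF : ∀ r t, U.op r (F t) = F (t + r) - F r := by
    intro r t
    rw [← ContinuousLinearMap.intervalIntegral_comp_comm _ (hint _ _)]
    simp only [← op_add_apply]
    rw [intervalIntegral.integral_comp_add_left (fun s => U.op s x) r, add_zero, add_comm r t]
    exact (intervalIntegral.integral_interval_sub_left (hint _ _) (hint _ _)).symm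
  have hF0 : F 0 = 0 := intervalIntegral.integral_same
  have hdom : ∀ t, F t ∈ U.generator.domain := by
    intro t
    refine ⟨U.op t x - U.op 0 x, ?_⟩
    have h1 := (hasDerivAt_iff_tendsto_slope_zero.1 (hF t)).sub
      (hasDerivAt_iff_tendsto_slope_zero.1 (hF 0))
    refine h1.congr fun r => ?_
    rw [hUF, ← smul_sub, hF0, zero_add, sub_zero, ← Complex.ofReal_inv, Complex.coe_smul]
    congr 1
    abel
  have htend : Tendsto (fun t : ℝ => t⁻¹ • F t) (𝓝[≠] 0) (𝓝 x) := by
    have := hasDerivAt_iff_tendsto_slope_zero.1 (hF 0)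
    simpa only [zero_add, hF0, sub_zero, op_zero_apply] using this
  have hseq : Tendsto (fun n : ℕ => 1 / ((n : ℝ) + 1)) atTop (𝓝[≠] 0) :=
    tendsto_nhdsWithin_iff.2 ⟨tendsto_one_div_add_atTop_nhds_zero_nat,
      Eventually.of_forall fun n => (by positivity : (1 / ((n : ℝ) + 1)) ≠ 0)⟩
  refine ⟨fun n => (1 / ((n : ℝ) + 1))⁻¹ • F (1 / ((n : ℝ) + 1)), fun n => ⟨?_, ?_⟩,
    htend.comp hseq⟩
  · beta_reduce
    rw [← Complex.coe_smul]
    exact U.generator.domain.smul_mem _ (hdom _)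
  · have hpos : (0 : ℝ) < 1 / ((n : ℝ) + 1) := by positivity
    have hle : 1 / ((n : ℝ) + 1) ≤ 1 := by
      rw [div_le_one (by positivity)]; linarith [n.cast_nonneg (α := ℝ)]
    have hm := hc.set_average_mem hK (μ := volume) (t := Set.Ioc (0 : ℝ) (1 / ((n : ℝ) + 1)))
      (f := fun s => U.op s x) (by simpa using hpos) (by simp)
      ((ae_restrict_mem measurableSet_Ioc).mono fun s hs => hx s ⟨hs.1.le, hs.2.trans hle⟩)
      ((intervalIntegrable_iff_integrableOn_Ioc_of_le hpos.le).1 (hint _ _))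
    rw [← Set.uIoc_of_le hpos.le, interval_average_eq, sub_zero] at hm
    exact hm

end Abstract

end Koopman.C0Group

/-! ### Products in `L_2` with a bounded factor. -/

namespace Koopman

section BoundedProducts

variable {X : Type*} [MeasurableSpace X] {μ : Measure X}

/-- `f` is bounded by `M` almost everywhere. -/
def EssBounded (M : ℝ) (f : Lp ℂ 2 μ) : Prop := ∀ᵐ x ∂μ, ‖f x‖ ≤ M

theorem EssBounded.add {M N : ℝ} {f g : Lp ℂ 2 μ} (hf : EssBounded M f) (hg : EssBounded N g) :
    EssBounded (M + N) (f + g) := by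
  filter_upwards [hf, hg, Lp.coeFn_add f g] with x h1 h2 h3
  rw [h3]
  exact (norm_add_le _ _).trans (add_le_add h1 h2)

theorem EssBounded.sub {M N : ℝ} {f g : Lp ℂ 2 μ} (hf : EssBounded M f) (hg : EssBounded N g) :
    EssBounded (M + N) (f - g) := by
  filter_upwards [hf, hg, Lp.coeFn_sub f g] with x h1 h2 h3
  rw [h3]
  exact (norm_sub_le _ _).trans (add_le_add h1 h2)

theorem EssBounded.smul {M : ℝ} {f : Lp ℂ 2 μ} (a : ℂ) (hf : EssBounded M f) :
    EssBounded (‖a‖ * M) (a • f) := by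
  filter_upwards [hf, Lp.coeFn_smul a f] with x h1 h2
  rw [h2, Pi.smul_apply, norm_smul]
  gcongr

theorem EssBounded.mono {M N : ℝ} {f : Lp ℂ 2 μ} (hf : EssBounded M f) (h : M ≤ N) :
    EssBounded N f :=
  Eventually.mono hf fun _ hx => hx.trans h

theorem essBounded_toReal_eLpNorm {f : Lp ℂ 2 μ} (hf : f ∈ L2Linfty μ) :
    EssBounded (eLpNorm f ∞ μ).toReal f := by
  have hf : MemLp (f : X → ℂ) ∞ μ := hf
  have h := ae_le_eLpNormEssSup (f := (f : X → ℂ)) (μ := μ)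
  filter_upwards [h] with x hx
  rw [← eLpNorm_exponent_top] at hx
  have := ENNReal.toReal_mono hf.2.ne hx
  simpa using this

theorem EssBounded.mem_L2Linfty {M : ℝ} {f : Lp ℂ 2 μ} (hf : EssBounded M f) : f ∈ L2Linfty μ :=
  memLp_top_of_bound (Lp.aestronglyMeasurable f) M hf

theorem mem_L2Linfty_iff {f : Lp ℂ 2 μ} : f ∈ L2Linfty μ ↔ ∃ M, 0 ≤ M ∧ EssBounded M f :=
  ⟨fun hf => ⟨_, ENNReal.toReal_nonneg, essBounded_toReal_eLpNorm hf⟩,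
    fun ⟨_, _, h⟩ => h.mem_L2Linfty⟩

theorem EssBounded.eLpNorm_le {M : ℝ} {f : Lp ℂ 2 μ} (hf : EssBounded M f) :
    eLpNorm f ∞ μ ≤ ENNReal.ofReal M := by
  rw [eLpNorm_exponent_top]
  exact eLpNormEssSup_le_of_ae_bound hf

theorem exists_seq_tendsto_ae {u : ℕ → Lp ℂ 2 μ} {f : Lp ℂ 2 μ} (h : Tendsto u atTop (𝓝 f)) :
    ∃ ns : ℕ → ℕ, StrictMono ns ∧
      ∀ᵐ x ∂μ, Tendsto (fun i => u (ns i) x) atTop (𝓝 (f x)) :=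
  (tendstoInMeasure_of_tendsto_Lp h).exists_seq_tendsto_ae

theorem isClosed_essBounded (M : ℝ) : IsClosed {f : Lp ℂ 2 μ | EssBounded M f} := by
  refine IsSeqClosed.isClosed fun u f hu huf => ?_
  obtain ⟨ns, -, hns⟩ := exists_seq_tendsto_ae huf
  filter_upwards [hns, ae_all_iff.2 hu] with x hx hb
  exact le_of_tendsto hx.norm (Eventually.of_forall fun i => hb (ns i))

open Classical in
/-- The pointwise product of two elements of `L_2`, with value `0` if it is not in `L_2`. -/
noncomputable def mul (f g : Lp ℂ 2 μ) : Lp ℂ 2 μ :=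
  if h : MemLp (fun x => f x * g x) 2 μ then h.toLp else 0

open Classical in
theorem mul_comm_Lp (f g : Lp ℂ 2 μ) : mul f g = mul g f := by
  exact congrArg (fun φ : X → ℂ => if h : MemLp φ 2 μ then h.toLp else 0)
    (funext fun x => mul_comm (f x) (g x))

theorem coeFn_mul (f : Lp ℂ 2 μ) {g : Lp ℂ 2 μ} {M : ℝ} (hg : EssBounded M g) :
    (mul f g : X → ℂ) =ᵐ[μ] fun x => f x * g x := by
  have h : MemLp (fun x => f x * g x) 2 μ := by
    refine (Lp.memLp f).of_le_mul (c := M)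
      ((Lp.aestronglyMeasurable f).mul (Lp.aestronglyMeasurable g)) ?_
    filter_upwards [hg] with x hx
    rw [norm_mul, mul_comm]
    gcongr
  rw [mul, dif_pos h]
  exact h.coeFn_toLp

theorem norm_mul_le_of_essBounded (f : Lp ℂ 2 μ) {g : Lp ℂ 2 μ} {M : ℝ} (hg : EssBounded M g) :
    ‖mul f g‖ ≤ M * ‖f‖ := by
  refine Lp.norm_le_mul_norm_of_ae_le_mul ?_
  filter_upwards [hg, coeFn_mul f hg] with x hx h
  rw [h, norm_mul, mul_comm]
  gcongr

theorem EssBounded.mul {M N : ℝ} {f g : Lp ℂ 2 μ} (hf : EssBounded M f) (hg : EssBounded N g) :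
    EssBounded (M * N) (mul f g) := by
  filter_upwards [hf, hg, coeFn_mul f hg] with x h1 h2 h3
  rw [h3, norm_mul]
  exact mul_le_mul h1 h2 (norm_nonneg _) ((norm_nonneg _).trans h1)

theorem add_mul' (f f' : Lp ℂ 2 μ) {g : Lp ℂ 2 μ} {M : ℝ} (hg : EssBounded M g) :
    mul (f + f') g = mul f g + mul f' g := by
  refine Lp.ext ?_
  filter_upwards [coeFn_mul (f + f') hg, coeFn_mul f hg, coeFn_mul f' hg, Lp.coeFn_add f f',
    Lp.coeFn_add (mul f g) (mul f' g)] with x h1 h2 h3 h4 h5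
  rw [h1, h5, h4, Pi.add_apply, Pi.add_apply, h2, h3, add_mul]

theorem smul_mul' (a : ℂ) (f : Lp ℂ 2 μ) {g : Lp ℂ 2 μ} {M : ℝ} (hg : EssBounded M g) :
    mul (a • f) g = a • mul f g := by
  refine Lp.ext ?_
  filter_upwards [coeFn_mul (a • f) hg, coeFn_mul f hg, Lp.coeFn_smul a f,
    Lp.coeFn_smul a (mul f g)] with x h1 h2 h3 h4
  rw [h1, h4, h3, Pi.smul_apply, Pi.smul_apply, h2, smul_mul_assoc]

theorem sub_mul' (f f' : Lp ℂ 2 μ) {g : Lp ℂ 2 μ} {M : ℝ} (hg : EssBounded M g) :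
    mul (f - f') g = mul f g - mul f' g := by
  rw [eq_sub_iff_add_eq, ← add_mul' _ _ hg, sub_add_cancel]

theorem mul_sub' (f : Lp ℂ 2 μ) {g g' : Lp ℂ 2 μ} {M N : ℝ} (hg : EssBounded M g)
    (hg' : EssBounded N g') : mul f (g - g') = mul f g - mul f g' := by
  refine Lp.ext ?_
  filter_upwards [coeFn_mul f (hg.sub hg'), coeFn_mul f hg, coeFn_mul f hg', Lp.coeFn_sub g g',
    Lp.coeFn_sub (mul f g) (mul f g')] with x h1 h2 h3 h4 h5
  rw [h1, h5, h4, Pi.sub_apply, Pi.sub_apply, h2, h3, mul_sub]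

theorem exists_essBounded_norm_sub_lt (f : Lp ℂ 2 μ) {ε : ℝ} (hε : 0 < ε) :
    ∃ (h : Lp ℂ 2 μ) (B : ℝ), EssBounded B h ∧ ‖f - h‖ < ε := by
  obtain ⟨h, hh⟩ := (Lp.simpleFunc.denseRange (E := ℂ) (μ := μ) (p := 2)
    ENNReal.ofNat_ne_top).exists_dist_lt f hε
  obtain ⟨B, hB⟩ := (Lp.simpleFunc.toSimpleFunc h).exists_forall_norm_le
  refine ⟨h, B, ?_, by rwa [← dist_eq_norm]⟩
  filter_upwards [Lp.simpleFunc.toSimpleFunc_eq_toFun h] with x hx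
  rw [← hx]
  exact hB x

/-- As `f` need not be bounded, split it as `(f - h) + h` with `h` bounded: the common bound on the
`g i` controls the first part, `L_2` convergence the second. -/
theorem tendsto_mul_const_left {ι : Type*} {l : Filter ι} (f : Lp ℂ 2 μ) {g : ι → Lp ℂ 2 μ}
    {g₀ : Lp ℂ 2 μ} {M : ℝ} (hg : Tendsto g l (𝓝 g₀)) (hgM : ∀ᶠ i in l, EssBounded M (g i))
    (hg₀ : EssBounded M g₀) : Tendsto (fun i => mul f (g i)) l (𝓝 (mul f g₀)) := by
  rw [tendsto_iff_norm_sub_tendsto_zero, Metric.tendsto_nhds]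
  intro ε hε
  obtain ⟨h, B, hB, hfh⟩ := exists_essBounded_norm_sub_lt f
    (show 0 < ε / (2 * (|M + M| + 1)) by positivity)
  have hd : ∀ᶠ i in l, (|B| + 1) * ‖g i - g₀‖ < ε / 2 := by
    have := (tendsto_iff_norm_sub_tendsto_zero.1 hg).const_mul (|B| + 1)
    rw [mul_zero] at this
    exact this.eventually_lt_const (by positivity)
  filter_upwards [hd, hgM] with i hi hgi
  have hb := (hgi.sub hg₀).mono (le_abs_self (M + M))
  have e : mul f (g i) - mul f g₀ = mul (f - h) (g i - g₀) + mul (g i - g₀) h := by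
    rw [sub_mul' _ _ hb, mul_comm_Lp _ h, sub_add_cancel, mul_sub' _ hgi hg₀]
  rw [dist_zero_right, norm_norm, e]
  have h1 := norm_mul_le_of_essBounded (f - h) (hb.mono (le_add_of_nonneg_right zero_le_one))
  have h2 := norm_mul_le_of_essBounded (g i - g₀) (hB.mono ((le_abs_self B).trans
    (le_add_of_nonneg_right zero_le_one)))
  have h3 : (|M + M| + 1) * ‖f - h‖ < ε / 2 := by
    rw [lt_div_iff₀ (by positivity)] at hfh
    linarith
  linarith [norm_add_le (mul (f - h) (g i - g₀)) (mul (g i - g₀) h)]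

theorem tendsto_mul {ι : Type*} {l : Filter ι} {f g : ι → Lp ℂ 2 μ} {f₀ g₀ : Lp ℂ 2 μ} {M : ℝ}
    (hf : Tendsto f l (𝓝 f₀)) (hg : Tendsto g l (𝓝 g₀))
    (hgM : ∀ᶠ i in l, EssBounded M (g i)) (hg₀ : EssBounded M g₀) :
    Tendsto (fun i => mul (f i) (g i)) l (𝓝 (mul f₀ g₀)) := by
  have h1 : Tendsto (fun i => mul (f i - f₀) (g i)) l (𝓝 0) := by
    have := (tendsto_iff_norm_sub_tendsto_zero.1 hf).const_mul M
    rw [mul_zero] at this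
    exact squeeze_zero_norm' (hgM.mono fun i hi => norm_mul_le_of_essBounded _ hi) this
  have h2 := h1.add (tendsto_mul_const_left f₀ hg hgM hg₀)
  rw [zero_add] at h2
  refine h2.congr' ?_
  filter_upwards [hgM] with i hi
  rw [sub_mul' _ _ hi, sub_add_cancel]

/-- The product rule for difference quotients in `L_2`. -/
theorem tendsto_slope_mul {u v : ℝ → Lp ℂ 2 μ} {u₀ v₀ a b : Lp ℂ 2 μ} {M : ℝ}
    (hu : Tendsto (fun r : ℝ => (r : ℂ)⁻¹ • (u r - u₀)) (𝓝[≠] 0) (𝓝 a))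
    (hv : Tendsto (fun r : ℝ => (r : ℂ)⁻¹ • (v r - v₀)) (𝓝[≠] 0) (𝓝 b))
    (hvt : Tendsto v (𝓝[≠] 0) (𝓝 v₀)) (hvM : ∀ᶠ r in 𝓝[≠] 0, EssBounded M (v r))
    (hu₀ : EssBounded M u₀) (hv₀ : EssBounded M v₀) :
    Tendsto (fun r : ℝ => (r : ℂ)⁻¹ • (mul (u r) (v r) - mul u₀ v₀)) (𝓝[≠] 0)
      (𝓝 (mul a v₀ + mul u₀ b)) := by
  -- Writing `u v - u₀ v₀ = (u - u₀) v + (v - v₀) u₀` leaves a bounded factor in each term, though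
  -- `a` and `b` may be unbounded.
  have h2 := tendsto_mul hv (tendsto_const_nhds (x := u₀)) (Eventually.of_forall fun _ => hu₀) hu₀
  rw [mul_comm_Lp b] at h2
  refine ((tendsto_mul hu hvt hvM hv₀).add h2).congr' ?_
  filter_upwards [hvM] with r hr
  rw [smul_mul' _ _ hr, smul_mul' _ _ hu₀, ← smul_add, sub_mul' _ _ hr, sub_mul' _ _ hu₀,
    mul_comm_Lp u₀ v₀, mul_comm_Lp u₀ (v r), sub_add_sub_cancel]

end BoundedProducts

end Koopman

/-! ### From multiplicative isomorphisms to point maps. -/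

namespace Koopman

section PointMap

variable {X : Type*} [MeasurableSpace X] {μ : Measure X}

theorem EssBounded.of_indicator {M : ℝ} {f g : Lp ℂ 2 μ} {B : Set X} (hf : EssBounded M f)
    (hg : (g : X → ℂ) =ᵐ[μ] B.indicator f) : EssBounded M g := by
  filter_upwards [hf, hg] with x h1 h2
  rw [h2]
  exact (norm_indicator_le_norm_self _ _).trans h1

theorem mem_L2Linfty_of_indicator {f g : Lp ℂ 2 μ} {B : Set X} (hf : f ∈ L2Linfty μ)
    (hg : (g : X → ℂ) =ᵐ[μ] B.indicator f) : g ∈ L2Linfty μ :=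
  ((essBounded_toReal_eLpNorm hf).of_indicator hg).mem_L2Linfty

theorem exists_coeFn_eq_indicator (f : Lp ℂ 2 μ) {B : Set X} (hB : MeasurableSet B) :
    ∃ g : Lp ℂ 2 μ, (g : X → ℂ) =ᵐ[μ] B.indicator f :=
  ⟨((Lp.memLp f).indicator hB).toLp, MemLp.coeFn_toLp _⟩

theorem measurableSet_ne_zero (f : Lp ℂ 2 μ) : MeasurableSet {x | f x ≠ 0} :=
  (Lp.stronglyMeasurable f).measurable (measurableSet_singleton 0).compl

theorem coeFn_mul_of_mem (f : Lp ℂ 2 μ) {g : Lp ℂ 2 μ} (hg : g ∈ L2Linfty μ) :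
    (mul f g : X → ℂ) =ᵐ[μ] fun x => f x * g x :=
  coeFn_mul f (essBounded_toReal_eLpNorm hg)

theorem eq_zero_iff_ae {f : Lp ℂ 2 μ} : f = 0 ↔ ∀ᵐ x ∂μ, f x = 0 :=
  Lp.eq_zero_iff_ae_eq_zero

/-- If `f² = f g`, then `f` is the restriction of `g` to the set where `f` does not vanish. -/
theorem eq_indicator_of_mul_self {f g : Lp ℂ 2 μ} (hf : f ∈ L2Linfty μ) (hg : g ∈ L2Linfty μ)
    (h : mul f f = mul f g) : (f : X → ℂ) =ᵐ[μ] {x | f x ≠ 0}.indicator g := by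
  have h1 := coeFn_mul_of_mem f hf
  rw [h] at h1
  filter_upwards [h1, coeFn_mul_of_mem f hg] with x h1 h2
  by_cases hx : f x = 0
  · simp [hx]
  · rw [Set.indicator_of_mem (by exact hx)]
    exact mul_left_cancel₀ hx (h1.symm.trans h2)

theorem mul_self_of_eq_indicator {f g : Lp ℂ 2 μ} {B : Set X} (hg : g ∈ L2Linfty μ)
    (h : (f : X → ℂ) =ᵐ[μ] B.indicator g) : mul f f = mul f g := by
  refine Lp.ext ?_
  filter_upwards [coeFn_mul_of_mem f (mem_L2Linfty_of_indicator hg h), coeFn_mul_of_mem f hg, h]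
    with x h1 h2 h3
  rw [h1, h2, h3]
  by_cases hx : x ∈ B <;> simp [hx]

/-- An invertible operator on `L_2` which, together with its inverse `S'`, leaves `L_2 ∩ L_∞`
invariant, and which is multiplicative there. -/
structure IsMulIso (S S' : Lp ℂ 2 μ →L[ℂ] Lp ℂ 2 μ) : Prop where
  right_inv : ∀ f, S (S' f) = f
  left_inv : ∀ f, S' (S f) = f
  mem : ∀ f ∈ L2Linfty μ, S f ∈ L2Linfty μ
  mem_inv : ∀ f ∈ L2Linfty μ, S' f ∈ L2Linfty μ
  map_mul : ∀ f ∈ L2Linfty μ, ∀ g ∈ L2Linfty μ, S (mul f g) = mul (S f) (S g)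

/-- `S` maps the restriction of `w` to `B` to the restriction of `S w` to `C`. -/
def Corresponds (S : Lp ℂ 2 μ →L[ℂ] Lp ℂ 2 μ) (w : Lp ℂ 2 μ) (B C : Set X) : Prop :=
  ∃ u : Lp ℂ 2 μ, (u : X → ℂ) =ᵐ[μ] B.indicator w ∧ (S u : X → ℂ) =ᵐ[μ] C.indicator (S w)

namespace IsMulIso

variable {S S' : Lp ℂ 2 μ →L[ℂ] Lp ℂ 2 μ} (hS : IsMulIso S S') {w : Lp ℂ 2 μ}
  (hw : w ∈ L2Linfty μ) (hw0 : ∀ᵐ x ∂μ, w x ≠ 0)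
include hS

theorem injective : Function.Injective S := Function.LeftInverse.injective hS.left_inv

include hw hw0

/-- Let `v` be `w` restricted to the zero set of `S w`. Then `S (S' v · w) = v · S w = 0`, so `S' v
= 0` and `v = 0`, which makes that set null. -/
theorem ae_map_ne_zero : ∀ᵐ x ∂μ, S w x ≠ 0 := by
  obtain ⟨v, hv⟩ := exists_coeFn_eq_indicator w (measurableSet_ne_zero (S w)).compl
  have hvm := mem_L2Linfty_of_indicator hw hv
  have h1 : S (mul (S' v) w) = 0 := by
    rw [hS.map_mul _ (hS.mem_inv _ hvm) _ hw, hS.right_inv, eq_zero_iff_ae]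
    filter_upwards [coeFn_mul_of_mem v (hS.mem _ hw), hv] with x h1 h2
    rw [h1, h2]
    by_cases hx : S w x = 0 <;> simp [hx]
  have h2 : mul (S' v) w = 0 := hS.injective (h1.trans (map_zero S).symm)
  have h3 : S' v = 0 := by
    rw [eq_zero_iff_ae] at h2 ⊢
    filter_upwards [h2, coeFn_mul_of_mem (S' v) hw, hw0] with x h1 h2 h3
    rw [h2] at h1
    exact (mul_eq_zero.1 h1).resolve_right h3
  have h4 : v = 0 := by rw [← hS.right_inv v, h3, map_zero]
  rw [eq_zero_iff_ae] at h4
  filter_upwards [h4, hv, hw0] with x h1 h2 h3 hx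
  rw [h1, Set.indicator_of_mem (by simpa using hx)] at h2
  exact h3 h2.symm

omit hw0 in
-- The equation `u² = u w` characterises restrictions of `w`, and `S` preserves it.
theorem exists_corresponds {B : Set X} (hB : MeasurableSet B) :
    ∃ C, MeasurableSet C ∧ Corresponds S w B C := by
  obtain ⟨u, hu⟩ := exists_coeFn_eq_indicator w hB
  have hum := mem_L2Linfty_of_indicator hw hu
  refine ⟨_, measurableSet_ne_zero (S u), u, hu,
    eq_indicator_of_mul_self (hS.mem _ hum) (hS.mem _ hw) ?_⟩
  rw [← hS.map_mul _ hum _ hum, ← hS.map_mul _ hum _ hw, mul_self_of_eq_indicator hw hu]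

omit hw0 in
theorem exists_corresponds_symm {C : Set X} (hC : MeasurableSet C) :
    ∃ B, MeasurableSet B ∧ Corresponds S w B C := by
  obtain ⟨v, hv⟩ := exists_coeFn_eq_indicator (S w) hC
  have hum := hS.mem_inv _ (mem_L2Linfty_of_indicator (hS.mem _ hw) hv)
  refine ⟨_, measurableSet_ne_zero (S' v), S' v,
    eq_indicator_of_mul_self hum hw (hS.injective ?_), by rwa [hS.right_inv]⟩
  rw [hS.map_mul _ hum _ hum, hS.map_mul _ hum _ hw, hS.right_inv,
    mul_self_of_eq_indicator (hS.mem _ hw) hv]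

theorem corresponds_inter {B B' C C' : Set X} (hB' : MeasurableSet B')
    (h : Corresponds S w B C) (h' : Corresponds S w B' C') :
    Corresponds S w (B ∩ B') (C ∩ C') := by
  obtain ⟨u, hu, hSu⟩ := h
  obtain ⟨u', hu', hSu'⟩ := h'
  obtain ⟨v, hv⟩ := exists_coeFn_eq_indicator u hB'
  have hum := mem_L2Linfty_of_indicator hw hu
  have hum' := mem_L2Linfty_of_indicator hw hu'
  have hvm := mem_L2Linfty_of_indicator hum hv
  -- After applying `S` to this identity, the factor `S w` can be cancelled.
  have e : mul u u' = mul v w := by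
    refine Lp.ext ?_
    filter_upwards [coeFn_mul_of_mem u hum', coeFn_mul_of_mem v hw, hu, hu', hv]
      with x h1 h2 h3 h4 h5
    rw [h1, h2, h5, h4]
    by_cases hx : x ∈ B' <;> simp [hx]
  have e' := congrArg S e
  rw [hS.map_mul _ hum _ hum', hS.map_mul _ hvm _ hw] at e'
  refine ⟨v, ?_, ?_⟩
  · filter_upwards [hu, hv] with x h1 h2
    rw [h2]
    by_cases hx : x ∈ B' <;> by_cases hx' : x ∈ B <;> simp [hx, hx', h1]
  · have h0 := coeFn_mul_of_mem (S v) (hS.mem _ hw)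
    rw [← e'] at h0
    filter_upwards [h0, coeFn_mul_of_mem (S u) (hS.mem _ hum'), hSu, hSu',
      hS.ae_map_ne_zero hw hw0] with x h1 h2 h3 h4 h5
    rw [h1, h3, h4] at h2
    refine mul_right_cancel₀ h5 (h2.trans ?_)
    by_cases hx : x ∈ C' <;> by_cases hx' : x ∈ C <;> simp [hx, hx']

omit hS hw hw0 in
theorem _root_.Koopman.Corresponds.compl {B C : Set X} (h : Corresponds S w B C) :
    Corresponds S w Bᶜ Cᶜ := by
  obtain ⟨u, hu, hSu⟩ := h
  refine ⟨w - u, ?_, ?_⟩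
  · filter_upwards [hu, Lp.coeFn_sub w u] with x h1 h2
    rw [h2, Pi.sub_apply, h1]
    by_cases hx : x ∈ B <;> simp [hx]
  · rw [map_sub]
    filter_upwards [hSu, Lp.coeFn_sub (S w) (S u)] with x h1 h2
    rw [h2, Pi.sub_apply, h1]
    by_cases hx : x ∈ C <;> simp [hx]

omit hw in
theorem ae_notMem_of_corresponds_right {B C : Set X} (h : Corresponds S w B C)
    (hC : ∀ᵐ x ∂μ, x ∉ C) : ∀ᵐ x ∂μ, x ∉ B := by
  obtain ⟨u, hu, hSu⟩ := h
  have h0 : S u = 0 := by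
    rw [eq_zero_iff_ae]
    filter_upwards [hSu, hC] with x h1 h2
    rw [h1, Set.indicator_of_notMem h2]
  have h1 : u = 0 := hS.injective (h0.trans (map_zero S).symm)
  rw [eq_zero_iff_ae] at h1
  filter_upwards [h1, hu, hw0] with x h1 h2 h3 hx
  rw [h1, Set.indicator_of_mem hx] at h2
  exact h3 h2.symm

theorem ae_notMem_of_corresponds_left {B C : Set X} (h : Corresponds S w B C)
    (hB : ∀ᵐ x ∂μ, x ∉ B) : ∀ᵐ x ∂μ, x ∉ C := by
  obtain ⟨u, hu, hSu⟩ := h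
  have h0 : u = 0 := by
    rw [eq_zero_iff_ae]
    filter_upwards [hu, hB] with x h1 h2
    rw [h1, Set.indicator_of_notMem h2]
  rw [h0, map_zero] at hSu
  filter_upwards [hSu, Lp.coeFn_zero ℂ 2 μ, hS.ae_map_ne_zero hw hw0] with x h1 h2 h3 hx
  rw [h2, Set.indicator_of_mem hx] at h1
  exact h3 h1.symm

omit hS hw hw0 in
theorem _root_.Koopman.Corresponds.congr_right {B C C' : Set X} (h : Corresponds S w B C)
    (hC : ∀ᵐ x ∂μ, (x ∈ C ↔ x ∈ C')) : Corresponds S w B C' := by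
  obtain ⟨u, hu, hSu⟩ := h
  refine ⟨u, hu, ?_⟩
  filter_upwards [hSu, hC] with x h1 h2
  rw [h1]
  by_cases hx : x ∈ C
  · rw [Set.indicator_of_mem hx, Set.indicator_of_mem (h2.1 hx)]
  · rw [Set.indicator_of_notMem hx, Set.indicator_of_notMem (mt h2.2 hx)]

/-- An order argument: let `D` correspond to `⋃ B n`. Each `C n \ D` corresponds to the empty set.
The set `D \ ⋃ C n` comes from some `B₀` almost disjoint from every `B n`, hence from their union,
so it is null too. -/
theorem corresponds_iUnion {B C : ℕ → Set X} (hB : ∀ n, MeasurableSet (B n))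
    (hC : ∀ n, MeasurableSet (C n)) (h : ∀ n, Corresponds S w (B n) (C n)) :
    Corresponds S w (⋃ n, B n) (⋃ n, C n) := by
  obtain ⟨D, hD, hBD⟩ := hS.exists_corresponds hw (MeasurableSet.iUnion hB)
  refine hBD.congr_right ?_
  have hsub : ∀ n, ∀ᵐ x ∂μ, x ∉ C n ∩ Dᶜ := fun n =>
    hS.ae_notMem_of_corresponds_left hw hw0
      (hS.corresponds_inter hw hw0 (MeasurableSet.iUnion hB).compl (h n) hBD.compl)
      (Eventually.of_forall fun x hx => hx.2 (Set.mem_iUnion_of_mem n hx.1))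
  obtain ⟨B₀, hB₀, hB₀D⟩ := hS.exists_corresponds_symm hw
    (hD.inter (MeasurableSet.iUnion hC).compl)
  have hdisj : ∀ n, ∀ᵐ x ∂μ, x ∉ B n ∩ B₀ := fun n =>
    hS.ae_notMem_of_corresponds_right hw0 (hS.corresponds_inter hw hw0 hB₀ (h n) hB₀D)
      (Eventually.of_forall fun x hx => hx.2.2 (Set.mem_iUnion_of_mem n hx.1))
  have hsup := hS.ae_notMem_of_corresponds_left hw hw0
    (hS.corresponds_inter hw hw0 hB₀ hBD hB₀D) (by
      filter_upwards [ae_all_iff.2 hdisj] with x hx hmem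
      obtain ⟨n, hn⟩ := Set.mem_iUnion.1 hmem.1
      exact hx n ⟨hn, hmem.2⟩)
  filter_upwards [hsup, ae_all_iff.2 hsub] with x h1 h2
  refine ⟨fun hx => ?_, fun hx => ?_⟩
  · by_contra hx'
    exact h1 ⟨hx, hx, hx'⟩
  · obtain ⟨n, hn⟩ := Set.mem_iUnion.1 hx
    by_contra hx'
    exact h2 n ⟨hn, hx'⟩

theorem exists_measurable_corresponds [StandardBorelSpace X] :
    ∃ T : X → X, Measurable T ∧
      ∀ B : Set X, MeasurableSet B → Corresponds S w B (T ⁻¹' B) := by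
  rcases isEmpty_or_nonempty X with hX | hX
  · exact ⟨id, measurable_id, fun B _ => ⟨w, Eventually.of_forall isEmptyElim,
      Eventually.of_forall isEmptyElim⟩⟩
  obtain ⟨e, hem, hei⟩ := MeasurableSpace.measurable_injection_nat_bool_of_countablySeparated X
  have he := hem.measurableEmbedding hei
  have hBm : ∀ n : ℕ, MeasurableSet {x | e x n = true} := fun n =>
    measurable_pi_iff.1 hem n (measurableSet_singleton true)
  choose C hCm hC using fun n => hS.exists_corresponds hw (hBm n)
  classical
  -- `E` plays the role of `e ∘ T`: its coordinates are prescribed by the sets `C n`.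
  let E : X → ℕ → Bool := fun x n => decide (x ∈ C n)
  have hpre : ∀ n, (fun x => E x n) ⁻¹' {true} = C n := fun n => by ext x; simp [E]
  have hEm : Measurable E := measurable_pi_iff.2 fun n =>
    measurable_to_bool (by rw [hpre]; exact hCm n)
  have hcor : ∀ s : Set (ℕ → Bool), MeasurableSet s →
      Corresponds S w (e ⁻¹' s) (E ⁻¹' s) := by
    -- The good sets form a σ-algebra containing the coordinate sets. Measurability of both
    -- preimages is carried along for the union step.
    let m : MeasurableSpace (ℕ → Bool) :=
      { MeasurableSet' := fun s => MeasurableSet (e ⁻¹' s) ∧ MeasurableSet (E ⁻¹' s) ∧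
          Corresponds S w (e ⁻¹' s) (E ⁻¹' s)
        measurableSet_empty := by
          refine ⟨by simp, by simp, 0, ?_, ?_⟩
          · simp only [Set.preimage_empty, Set.indicator_empty]
            exact Lp.coeFn_zero ℂ 2 μ
          · simp only [Set.preimage_empty, Set.indicator_empty, map_zero]
            exact Lp.coeFn_zero ℂ 2 μ
        measurableSet_compl := fun s hs => ⟨hs.1.compl, hs.2.1.compl, hs.2.2.compl⟩
        measurableSet_iUnion := fun s hs => by
          simp only [Set.preimage_iUnion]
          exact ⟨MeasurableSet.iUnion fun n => (hs n).1, MeasurableSet.iUnion fun n => (hs n).2.1,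
            hS.corresponds_iUnion hw hw0 (fun n => (hs n).1) (fun n => (hs n).2.1)
              fun n => (hs n).2.2⟩ }
    have hle : (MeasurableSpace.pi : MeasurableSpace (ℕ → Bool)) ≤ m := by
      refine iSup_le fun n => Measurable.comap_le ?_
      refine measurable_to_bool (f := fun b : ℕ → Bool => b n) ?_
      refine ⟨hBm n, ?_, ?_⟩
      · exact (hpre n).symm ▸ hCm n
      · exact (hpre n).symm ▸ hC n
    exact fun s hs => (hle s hs).2.2
  obtain ⟨e', he'm, he'⟩ := he.exists_measurable_extend measurable_id fun _ => hX
  -- The complement of the range has empty preimage under `e`, hence null preimage under `E`; so `e`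
  -- can be inverted almost everywhere.
  have hrange : ∀ᵐ x ∂μ, E x ∈ Set.range e := by
    have h1 := hcor _ he.measurableSet_range.compl
    have h2 := hS.ae_notMem_of_corresponds_left hw hw0 h1
      (Eventually.of_forall fun x hx => hx ⟨x, rfl⟩)
    simpa using h2
  refine ⟨e' ∘ E, he'm.comp hEm, fun B hB => ?_⟩
  have h := hcor _ (he.measurableSet_image.2 hB)
  rw [hei.preimage_image] at h
  refine h.congr_right ?_
  filter_upwards [hrange] with x hx
  obtain ⟨y, hy⟩ := hx
  have h3 : e' (e y) = y := congrFun he' y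
  simp only [Set.mem_preimage, Function.comp, ← hy, h3, hei.mem_set_image]

omit hw hw0 in
theorem exists_isCompositionWith [StandardBorelSpace X] [SigmaFinite μ] :
    ∃ T : X → X, Measurable T ∧ IsCompositionWith S T := by
  obtain ⟨w, hw, hw0⟩ : ∃ w ∈ L2Linfty μ, ∀ᵐ x ∂μ, w x ≠ 0 := by
    -- Take `w = min g 1`, which is bounded by `1` and square integrable since `w² ≤ g`.
    obtain ⟨g, hg0, hgm, hg⟩ := exists_pos_lintegral_lt_of_sigmaFinite μ one_ne_zero
    have hm : Measurable fun x => ((min (g x) 1 : NNReal) : ℂ) :=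
      Complex.measurable_ofReal.comp (measurable_coe_nnreal_real.comp (hgm.min measurable_const))
    have hn : ∀ x, ‖((min (g x) 1 : NNReal) : ℂ)‖ = (min (g x) 1 : NNReal) := fun x => by simp
    have hL : MemLp (fun x => ((min (g x) 1 : NNReal) : ℂ)) 2 μ := by
      rw [memLp_two_iff_integrable_sq_norm hm.aestronglyMeasurable]
      have hgi : Integrable (fun x => (g x : ℝ)) μ := by
        refine ⟨(measurable_coe_nnreal_real.comp hgm).aestronglyMeasurable, ?_⟩
        rw [hasFiniteIntegral_iff_enorm]
        simpa using hg.trans ENNReal.one_lt_top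
      refine hgi.mono' (hm.norm.pow_const 2).aestronglyMeasurable (Eventually.of_forall fun x => ?_)
      rw [hn, norm_pow, NNReal.norm_eq]
      norm_cast
      calc (min (g x) 1) ^ 2 = min (g x) 1 * min (g x) 1 := sq _
        _ ≤ g x * 1 := mul_le_mul' (min_le_left _ _) (min_le_right _ _)
        _ = g x := mul_one _
    refine ⟨hL.toLp, EssBounded.mem_L2Linfty (M := 1) ?_, ?_⟩
    · filter_upwards [hL.coeFn_toLp] with x hx
      rw [hx, hn]
      exact_mod_cast min_le_right _ _
    · filter_upwards [hL.coeFn_toLp] with x hx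
      rw [hx]
      have : 0 < min (g x) 1 := lt_min (hg0 x) one_pos
      exact_mod_cast this.ne'
  obtain ⟨T, hTm, hT⟩ := hS.exists_measurable_corresponds hw hw0
  -- Preimages of null sets are null, so composition with `T` respects almost everywhere equality.
  have hq : Measure.QuasiMeasurePreserving T μ μ := by
    refine ⟨hTm, Measure.AbsolutelyContinuous.mk fun B hB h0 => ?_⟩
    rw [Measure.map_apply hTm hB]
    exact measure_eq_zero_iff_ae_notMem.2 (hS.ae_notMem_of_corresponds_left hw hw0 (hT B hB)
      (measure_eq_zero_iff_ae_notMem.1 h0))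
  refine ⟨T, hTm, ?_⟩
  suffices h : ∀ f : Lp ℂ 2 μ, (S f : X → ℂ) =ᵐ[μ] f ∘ T from
    fun f hf => (h _).trans (hq.ae_eq hf.coeFn_toLp)
  intro f
  refine Lp.induction ENNReal.ofNat_ne_top (fun f : Lp ℂ 2 μ => (S f : X → ℂ) =ᵐ[μ] f ∘ T)
    ?_ ?_ ?_ f
  · intro c B hB hμB
    obtain ⟨u, hu, hSu⟩ := hT B hB
    have hv : ((Lp.simpleFunc.indicatorConst 2 hB hμB.ne c : Lp ℂ 2 μ) : X → ℂ) =ᵐ[μ]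
        B.indicator fun _ => c := by
      rw [Lp.simpleFunc.coe_indicatorConst]
      exact indicatorConstLp_coeFn
    generalize (Lp.simpleFunc.indicatorConst 2 hB hμB.ne c : Lp ℂ 2 μ) = v at hv ⊢
    have hvm : v ∈ L2Linfty μ := by
      refine EssBounded.mem_L2Linfty (M := ‖c‖) ?_
      filter_upwards [hv] with x hx
      rw [hx]
      exact norm_indicator_le_norm_self (fun _ => c) x
    have e : mul v w = c • u := by
      refine Lp.ext ?_
      filter_upwards [coeFn_mul_of_mem v hw, hu, Lp.coeFn_smul c u, hv] with x h1 h2 h3 h4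
      rw [h1, h3, Pi.smul_apply, h2, h4]
      by_cases hx : x ∈ B <;> simp [hx]
    have e' := congrArg S e
    rw [hS.map_mul _ hvm _ hw, map_smul] at e'
    have h0 := coeFn_mul_of_mem (S v) (hS.mem _ hw)
    rw [e'] at h0
    filter_upwards [h0, Lp.coeFn_smul c (S u), hSu, hS.ae_map_ne_zero hw hw0, hq.ae_eq hv]
      with x h1 h2 h3 h4 h5
    rw [h5]
    refine mul_right_cancel₀ h4 (h1.symm.trans ?_)
    rw [h2, Pi.smul_apply, h3]
    by_cases hx : T x ∈ B <;> simp [hx]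
  · intro f g hf hg _ hf' hg'
    rw [map_add]
    filter_upwards [Lp.coeFn_add (S (hf.toLp f)) (S (hg.toLp g)), hf', hg',
      hq.ae_eq (Lp.coeFn_add (hf.toLp f) (hg.toLp g))] with x h1 h2 h3 h4
    rw [h1, h4, Pi.add_apply, h2, h3]
    rfl
  · refine IsSeqClosed.isClosed fun u f hu huf => ?_
    obtain ⟨ns, hmono, hns⟩ := exists_seq_tendsto_ae huf
    obtain ⟨ms, hms_mono, hms⟩ := exists_seq_tendsto_ae
      (((S.continuous.tendsto f).comp huf).comp hmono.tendsto_atTop)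
    filter_upwards [hms, hq.ae hns, ae_all_iff.2 hu] with x h1 h2 h3
    refine tendsto_nhds_unique h1 ?_
    simp only [Function.comp, h3] at h2 ⊢
    exact h2.comp hms_mono.tendsto_atTop

end IsMulIso

end PointMap

end Koopman

/-! ### Composition groups and derivations. -/

namespace Koopman

section CompositionGroups

variable {X : Type*} [MeasurableSpace X] {μ : Measure X}

theorem IsCompositionWith.coeFn {S : Lp ℂ 2 μ →L[ℂ] Lp ℂ 2 μ} {T : X → X}
    (hT : IsCompositionWith S T) (f : Lp ℂ 2 μ) : (S f : X → ℂ) =ᵐ[μ] f ∘ T := by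
  have h := hT f (Lp.memLp f)
  rwa [Lp.toLp_coeFn] at h

/-- Cutting off `f` where it exceeds `M` gives a representative bounded everywhere, and this bound
survives composition with any map. -/
theorem IsCompositionWith.essBounded {S : Lp ℂ 2 μ →L[ℂ] Lp ℂ 2 μ} {T : X → X}
    (hT : IsCompositionWith S T) {M : ℝ} (hM : 0 ≤ M) {f : Lp ℂ 2 μ} (hf : EssBounded M f) :
    EssBounded M (S f) := by
  have hm : MeasurableSet {x | ‖f x‖ ≤ M} :=
    measurableSet_le (Lp.stronglyMeasurable f).norm.measurable measurable_const
  have hL := (Lp.memLp f).indicator hm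
  have e : hL.toLp = f := by
    refine Lp.ext ?_
    filter_upwards [hL.coeFn_toLp, hf] with x h1 h2
    rw [h1, Set.indicator_of_mem (by exact h2)]
  have h := hT _ hL
  rw [e] at h
  filter_upwards [h] with x hx
  rw [hx, Function.comp]
  by_cases hy : ‖f (T x)‖ ≤ M
  · rwa [Set.indicator_of_mem (by exact hy)]
  · rwa [Set.indicator_of_notMem (by exact hy), norm_zero]

theorem IsCompositionWith.map_mul {S : Lp ℂ 2 μ →L[ℂ] Lp ℂ 2 μ} {T : X → X}
    (hT : IsCompositionWith S T) (f : Lp ℂ 2 μ) {g : Lp ℂ 2 μ} {M : ℝ} (hM : 0 ≤ M)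
    (hg : EssBounded M g) : S (mul f g) = mul (S f) (S g) := by
  have hL : MemLp (fun x => f x * g x) 2 μ := (memLp_congr_ae (coeFn_mul f hg)).1 (Lp.memLp _)
  have e : hL.toLp = mul f g := Lp.ext (hL.coeFn_toLp.trans (coeFn_mul f hg).symm)
  refine Lp.ext ?_
  have h := hT _ hL
  rw [e] at h
  filter_upwards [h, hT.coeFn f, hT.coeFn g, coeFn_mul (S f) (hT.essBounded hM hg)]
    with x h1 h2 h3 h4
  rw [h1, h4, h2, h3]
  rfl

theorem coeFn_mul_add_mul {f g a b : Lp ℂ 2 μ} (hf : f ∈ L2Linfty μ) (hg : g ∈ L2Linfty μ) :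
    (mul a g + mul f b : Lp ℂ 2 μ) =ᵐ[μ] fun x => a x * g x + f x * b x := by
  have h := coeFn_mul_of_mem b hf
  rw [mul_comm_Lp] at h
  filter_upwards [h, coeFn_mul_of_mem a hg, Lp.coeFn_add (mul a g) (mul f b)] with x h1 h2 h3
  rw [h3, Pi.add_apply, h1, h2, mul_comm (b x)]

variable (U : C0Group (Lp ℂ 2 μ))

theorem tendsto_slope_orbit_mul {f g a b : Lp ℂ 2 μ} (hf : U.HasGenerator f a)
    (hg : U.HasGenerator g b) (s : ℝ) {M : ℝ}
    (hfM : EssBounded M (U.op s f)) (hgM : EssBounded M (U.op s g))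
    (hM : ∀ᶠ r : ℝ in 𝓝[≠] 0, EssBounded M (U.op (s + r) g)) :
    Tendsto (fun r : ℝ => (r : ℂ)⁻¹ •
        (mul (U.op (s + r) f) (U.op (s + r) g) - mul (U.op s f) (U.op s g))) (𝓝[≠] 0)
      (𝓝 (mul (U.op s a) (U.op s g) + mul (U.op s f) (U.op s b))) := by
  refine tendsto_slope_mul (hf.tendsto_orbit s) (hg.tendsto_orbit s) ?_ hM hfM hgM
  have h := ((U.op s).continuous.tendsto g).comp (U.tendsto_op_zero g)
  refine h.congr fun r => ?_
  rw [C0Group.op_add_apply]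
  rfl

variable {U}

/-- The generator of a group of composition operators is a derivation. -/
theorem hasGenerator_mul_of_isCompositionWith
    (hU : ∀ t : ℝ, ∃ T : X → X, Measurable T ∧ IsCompositionWith (U.op t) T)
    {f g a b : Lp ℂ 2 μ} (hf : U.HasGenerator f a) (hg : U.HasGenerator g b)
    (hfm : f ∈ L2Linfty μ) (hgm : g ∈ L2Linfty μ) :
    U.HasGenerator (mul f g) (mul a g + mul f b) := by
  choose T _ hT using hU
  obtain ⟨M, hM, hfM⟩ := mem_L2Linfty_iff.1 hfm
  obtain ⟨N, hN, hgN⟩ := mem_L2Linfty_iff.1 hgm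
  have h0 : 0 ≤ max M N := hM.trans (le_max_left _ _)
  have hf' := hfM.mono (le_max_left M N)
  have hg' := hgN.mono (le_max_right M N)
  have h := tendsto_slope_orbit_mul U hf hg 0 ((hT 0).essBounded h0 hf')
    ((hT 0).essBounded h0 hg') (Eventually.of_forall fun r => (hT _).essBounded h0 hg')
  simp only [zero_add, C0Group.op_zero_apply] at h
  refine h.congr fun r => ?_
  rw [(hT r).map_mul f hN hgN]

/-- If `U_t` is bounded in the norm of `L_∞` for `t ∈ [-1, 1]`, then it is so locally uniformly
in `t`. -/
theorem exists_essBounded_op {c : ℝ} (hc : 0 < c)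
    (h : ∀ t ∈ Set.Icc (-1 : ℝ) 1, ∀ f ∈ L2Linfty μ,
      eLpNorm (U.op t f : X → ℂ) ∞ μ ≤ ENNReal.ofReal c * eLpNorm (f : X → ℂ) ∞ μ) (n : ℕ) :
    ∃ K, 0 ≤ K ∧ ∀ t : ℝ, |t| ≤ n → ∀ (M : ℝ) (f : Lp ℂ 2 μ), 0 ≤ M → EssBounded M f →
      EssBounded (K * M) (U.op t f) := by
  have h1 : ∀ t ∈ Set.Icc (-1 : ℝ) 1, ∀ (M : ℝ) (f : Lp ℂ 2 μ), 0 ≤ M → EssBounded M f →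
      EssBounded (c * M) (U.op t f) := by
    intro t ht M f hM hf
    have h2 : eLpNorm (U.op t f : X → ℂ) ∞ μ ≤ ENNReal.ofReal (c * M) := by
      rw [ENNReal.ofReal_mul hc.le]
      exact (h t ht f hf.mem_L2Linfty).trans (mul_le_mul_right hf.eLpNorm_le _)
    have h3 : U.op t f ∈ L2Linfty μ :=
      ⟨Lp.aestronglyMeasurable _, h2.trans_lt ENNReal.ofReal_lt_top⟩
    exact (essBounded_toReal_eLpNorm h3).mono (ENNReal.toReal_le_of_le_ofReal (by positivity) h2)
  induction n with
  | zero =>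
    refine ⟨1, zero_le_one, fun t ht M f _ hf => ?_⟩
    rw [Nat.cast_zero, abs_nonpos_iff] at ht
    rwa [ht, C0Group.op_zero_apply, one_mul]
  | succ n ih =>
    obtain ⟨K, hK, ih⟩ := ih
    refine ⟨c * K, by positivity, fun t ht M f hM hf => ?_⟩
    have hn : (0 : ℝ) < n + 1 := by positivity
    push_cast at ht
    -- One step of length at most `1`, costing the factor `c`, and a remainder of length at most
    -- `n`.
    have e : t = t / (n + 1) + n * (t / (n + 1)) := by field_simp; ring
    have hs : |t / (n + 1)| ≤ 1 := by
      rwa [abs_div, abs_of_pos hn, div_le_one hn]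
    rw [e, C0Group.op_add_apply, mul_assoc]
    refine h1 _ (abs_le.1 hs) _ _ (by positivity) (ih _ ?_ M f hM hf)
    rw [abs_mul, Nat.abs_cast]
    exact mul_le_of_le_one_right n.cast_nonneg hs

theorem op_mul_of_isDerivationOn
    (halg : IsFunctionAlgebra (U.generator.domain ⊓ L2Linfty μ))
    (hder : IsDerivationOn U.generator (U.generator.domain ⊓ L2Linfty μ))
    (hbd : ∀ n : ℕ, ∃ K, 0 ≤ K ∧ ∀ t : ℝ, |t| ≤ n → ∀ (M : ℝ) (f : Lp ℂ 2 μ), 0 ≤ M →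
      EssBounded M f → EssBounded (K * M) (U.op t f))
    {f g : Lp ℂ 2 μ} (hf : f ∈ U.generator.domain ⊓ L2Linfty μ)
    (hg : g ∈ U.generator.domain ⊓ L2Linfty μ) (t : ℝ) :
    U.op t (mul f g) = mul (U.op t f) (U.op t g) := by
  obtain ⟨⟨a, ha⟩, hfm⟩ := hf
  obtain ⟨⟨b, hb⟩, hgm⟩ := hg
  obtain ⟨M, hM, hfM⟩ := mem_L2Linfty_iff.1 hfm
  obtain ⟨N, hN, hgN⟩ := mem_L2Linfty_iff.1 hgm
  have h0 : 0 ≤ max M N := hM.trans (le_max_left _ _)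
  have hf' := hfM.mono (le_max_left M N)
  have hg' := hgN.mono (le_max_right M N)
  -- The product rule at `s` needs a sup bound for the orbit of `g` uniform near `s`.
  have hloc : ∀ s : ℝ, ∃ L, EssBounded L (U.op s f) ∧ EssBounded L (U.op s g) ∧
      ∀ᶠ r : ℝ in 𝓝[≠] 0, EssBounded L (U.op (s + r) g) := by
    intro s
    obtain ⟨n, hn⟩ := exists_nat_ge (|s| + 1)
    obtain ⟨K, -, hK⟩ := hbd n
    refine ⟨K * max M N, hK s (by linarith) _ _ h0 hf', hK s (by linarith) _ _ h0 hg', ?_⟩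
    have hr : ∀ᶠ r : ℝ in 𝓝[≠] 0, r ∈ Set.Icc (-1 : ℝ) 1 :=
      nhdsWithin_le_nhds (Icc_mem_nhds (by norm_num) (by norm_num))
    filter_upwards [hr] with r hr
    exact hK _ (by linarith [abs_add_le s r, abs_le.2 hr]) _ _ h0 hg'
  have h := U.eq_op_of_hasGenerator (h := fun s => mul (U.op s f) (U.op s g))
    (h' := fun s => mul (U.op s a) (U.op s g) + mul (U.op s f) (U.op s b)) ?_ ?_ t
  · simpa only [C0Group.op_zero_apply] using h.symm
  · intro s
    obtain ⟨L, h1, h2, h3⟩ := hloc s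
    exact tendsto_slope_orbit_mul U ha hb s h1 h2 h3
  · intro s
    obtain ⟨L, h1, h2, -⟩ := hloc s
    have hfD : U.op s f ∈ U.generator.domain ⊓ L2Linfty μ := ⟨⟨_, ha.op s⟩, h1.mem_L2Linfty⟩
    have hgD : U.op s g ∈ U.generator.domain ⊓ L2Linfty μ := ⟨⟨_, hb.op s⟩, h2.mem_L2Linfty⟩
    obtain ⟨k, hk, hke⟩ := halg _ hfD _ hgD
    have hkm : k = mul (U.op s f) (U.op s g) := Lp.ext (hke.trans (coeFn_mul _ h2).symm)
    have hd := hder.2 ⟨_, hfD.1⟩ ⟨_, hgD.1⟩ ⟨k, hk.1⟩ hfD hgD hk hke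
    have hAf : U.generator ⟨_, hfD.1⟩ = U.op s a :=
      (C0Group.hasGenerator_generator ⟨_, hfD.1⟩).unique (ha.op s)
    have hAg : U.generator ⟨_, hgD.1⟩ = U.op s b :=
      (C0Group.hasGenerator_generator ⟨_, hgD.1⟩).unique (hb.op s)
    rw [hAf, hAg] at hd
    have hA : U.generator ⟨k, hk.1⟩ = mul (U.op s a) (U.op s g) + mul (U.op s f) (U.op s b) :=
      Lp.ext (hd.trans (coeFn_mul_add_mul hfD.2 hgD.2).symm)
    rw [← hA, ← hkm]
    exact C0Group.hasGenerator_generator ⟨k, hk.1⟩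

/-- Mere `L_2` density of `D(A) ∩ L_∞` would not suffice for passing to the limit in products; the
approximants must be uniformly bounded, as must their images under `U_t`. -/
theorem isMulIso_op
    (halg : IsFunctionAlgebra (U.generator.domain ⊓ L2Linfty μ))
    (hder : IsDerivationOn U.generator (U.generator.domain ⊓ L2Linfty μ))
    (hbd : ∀ n : ℕ, ∃ K, 0 ≤ K ∧ ∀ t : ℝ, |t| ≤ n → ∀ (M : ℝ) (f : Lp ℂ 2 μ), 0 ≤ M →
      EssBounded M f → EssBounded (K * M) (U.op t f)) (t : ℝ) :
    IsMulIso (U.op t) (U.op (-t)) := by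
  have hmem : ∀ s, ∀ f ∈ L2Linfty μ, U.op s f ∈ L2Linfty μ := by
    intro s f hf
    obtain ⟨M, hM, hfM⟩ := mem_L2Linfty_iff.1 hf
    obtain ⟨n, hn⟩ := exists_nat_ge |s|
    obtain ⟨K, -, hK⟩ := hbd n
    exact (hK s hn M f hM hfM).mem_L2Linfty
  have happ : ∀ f ∈ L2Linfty μ, ∃ (u : ℕ → Lp ℂ 2 μ) (L : ℝ), 0 ≤ L ∧ EssBounded L f ∧
      (∀ n, u n ∈ U.generator.domain ⊓ L2Linfty μ ∧ EssBounded L (u n)) ∧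
      Tendsto u atTop (𝓝 f) := by
    intro f hf
    obtain ⟨M, hM, hfM⟩ := mem_L2Linfty_iff.1 hf
    obtain ⟨K, hK0, hK⟩ := hbd 1
    have horb : ∀ s ∈ Set.Icc (0 : ℝ) 1, EssBounded (K * M) (U.op s f) := fun s hs =>
      hK s (by rw [abs_of_nonneg hs.1]; simpa using hs.2) M f hM hfM
    -- The sup-norm ball of radius `K * M` is convex, closed in `L_2`, and contains the orbit of `f`
    -- over `[0, 1]`.
    obtain ⟨u, hu, hut⟩ := U.exists_seq_domain_tendsto (isClosed_essBounded (μ := μ) (K * M))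
      (by
        intro x hx y hy a b ha hb hab
        have h := EssBounded.add (EssBounded.smul (a : ℂ) hx) (EssBounded.smul (b : ℂ) hy)
        rwa [Complex.norm_real, Complex.norm_real, Real.norm_of_nonneg ha,
          Real.norm_of_nonneg hb, ← add_mul, hab, one_mul] at h) (x := f) horb
    have hf0 := horb 0 (by simp)
    rw [C0Group.op_zero_apply] at hf0
    exact ⟨u, K * M, by positivity, hf0,
      fun n => ⟨⟨(hu n).1, EssBounded.mem_L2Linfty (hu n).2⟩, (hu n).2⟩, hut⟩
  refine ⟨U.op_op_neg_apply t, U.op_neg_op_apply t, hmem t, hmem (-t), fun f hf g hg => ?_⟩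
  obtain ⟨u, L, -, -, hu, hut⟩ := happ f hf
  obtain ⟨v, L', hL', hgL', hv, hvt⟩ := happ g hg
  obtain ⟨n, hn⟩ := exists_nat_ge |t|
  obtain ⟨K, -, hK⟩ := hbd n
  have h1 := ((U.op t).continuous.tendsto _).comp
    (tendsto_mul hut hvt (Eventually.of_forall fun n => (hv n).2) hgL')
  have h2 := tendsto_mul (((U.op t).continuous.tendsto _).comp hut)
    (((U.op t).continuous.tendsto _).comp hvt)
    (Eventually.of_forall fun n => hK t hn L' _ hL' (hv n).2) (hK t hn L' g hL' hgL')
  refine tendsto_nhds_unique h1 (h2.congr fun n => ?_)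
  exact (op_mul_of_isDerivationOn halg hder hbd (hu n).1 (hv n).1 t).symm

end CompositionGroups

end Koopman

theorem theorem2p8 {X : Type*} [MeasurableSpace X] [StandardBorelSpace X]
    (μ : Measure X) [SigmaFinite μ] (U : Koopman.C0Group (Lp ℂ 2 μ)) :
    (∀ t : ℝ, ∃ T : X → X, Measurable T ∧ Koopman.IsCompositionWith (U.op t) T) ↔
      (Koopman.IsFunctionAlgebra (U.generator.domain ⊓ Koopman.L2Linfty μ) ∧
        Koopman.IsDerivationOn U.generator (U.generator.domain ⊓ Koopman.L2Linfty μ) ∧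
        ∃ c : ℝ, 0 < c ∧ ∀ t ∈ Set.Icc (-1 : ℝ) 1, ∀ f ∈ Koopman.L2Linfty μ,
          eLpNorm (U.op t f : X → ℂ) ∞ μ ≤ ENNReal.ofReal c * eLpNorm (f : X → ℂ) ∞ μ) := by
  constructor
  · intro hU
    refine ⟨?_, ⟨inf_le_left, ?_⟩, 1, one_pos, ?_⟩
    · rintro f ⟨⟨a, ha⟩, hf⟩ g ⟨⟨b, hb⟩, hg⟩
      exact ⟨Koopman.mul f g,
        ⟨⟨_, Koopman.hasGenerator_mul_of_isCompositionWith hU ha hb hf hg⟩,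
          ((Koopman.essBounded_toReal_eLpNorm hf).mul
            (Koopman.essBounded_toReal_eLpNorm hg)).mem_L2Linfty⟩,
        Koopman.coeFn_mul_of_mem f hg⟩
    · intro f g h hf hg _ hfg
      have e : (h : Lp ℂ 2 μ) = Koopman.mul f g :=
        Lp.ext (hfg.trans (Koopman.coeFn_mul_of_mem _ hg.2).symm)
      have hgen := Koopman.C0Group.hasGenerator_generator h
      rw [e] at hgen
      rw [hgen.unique (Koopman.hasGenerator_mul_of_isCompositionWith hU
        (Koopman.C0Group.hasGenerator_generator f) (Koopman.C0Group.hasGenerator_generator g)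
        hf.2 hg.2)]
      exact Koopman.coeFn_mul_add_mul hf.2 hg.2
    · intro t _ f hf
      obtain ⟨T, -, hT⟩ := hU t
      have hf' : MemLp (f : X → ℂ) ∞ μ := hf
      have h := (hT.essBounded ENNReal.toReal_nonneg
        (Koopman.essBounded_toReal_eLpNorm hf)).eLpNorm_le
      rwa [ENNReal.ofReal_toReal hf'.2.ne, ← one_mul (eLpNorm (f : X → ℂ) ∞ μ),
        ← ENNReal.ofReal_one] at h
  · rintro ⟨halg, hder, c, hc, hbd⟩ t
    exact (Koopman.isMulIso_op halg hder (Koopman.exists_essBounded_op hc hbd)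
      t).exists_isCompositionWith
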